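/- For a finite group $G$ acting on a set $\Omega$ and a prime $p$, say that the action has Property $(*)_p$ if, for every Sylow $p$-subgroup $P$ of $G$ and every $\omega\in\Omega$, the stabiliser $P_\omega$ is a Sylow $p$-subgroup of $G_\omega$; for a positive integer $n$ let $n_p$ denote the highest power of $p$ dividing $n$. Let $q$ be an even prime power and let $\mathcal C$ be the nonsingular conic $y^2=xz$ in the Desarguesian projective plane $\mathrm{PG}(2,q)$, whose points are the points $[s^2:st:t^2]$ with $[s:t]$ on the projective line over $\mathbb F_q$. Let $G=\mathrm{PSL}_2(q)$ act on the plane preserving $\mathcal C$ in the natural way, so that $g\in G$ takes $[s^2:st:t^2]$ to $[s'^2:s't':t'^2]$ where $(s',t')=g(s,t)$. Let $\Omega$ be the set of external lines to $\mathcal C$ (the lines of the plane containing no point of $\mathcal C$), and let $n=|\Omega|$. Then $n=\binom q2=q(q-1)/2$, the group $G$ acts transitively on $\Omega$, and this action has Property $(*)_2$. Moreover, $2n_2<n$ if $q\ge 4$, and the stabiliser in $G$ of a point of $\Omega$ is isomorphic to the dihedral group of order $2(q+1)$; in particular it has even order. -/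

import Mathlib

open scoped LinearAlgebra.Projectivization

/-- Property `(*)_p` of a group `G` acting on `Ω`: for every Sylow `p`-subgroup `P` of `G` and every
point `ω`, the stabiliser `P_ω = P ∩ G_ω` is a Sylow `p`-subgroup of `G_ω`. -/
def HasPropertyStar (p : ℕ) (G Ω : Type*) [Group G] [MulAction G Ω] : Prop :=
  ∀ (P : Sylow p G) (ω : Ω), ∃ Q : Sylow p (MulAction.stabilizer G ω),
    (Q : Subgroup (MulAction.stabilizer G ω)) =
      (P : Subgroup G).subgroupOf (MulAction.stabilizer G ω)

namespace Conic

/-- The nonsingular conic `y ^ 2 = x z` of the projective plane over `K`. It consists of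
the points `[s ^ 2 : s t : t ^ 2]` with `[s : t]` on the projective line. -/
def conic (K : Type*) [Field K] : Set (ℙ K (Fin 3 → K)) :=
  {p | p.rep 1 ^ 2 = p.rep 0 * p.rep 2}

/-- The lines of the projective plane over `K` (as two-dimensional subspaces of `K ^ 3`) that
contain no point of the conic. -/
@[ext]
structure ExternalLine (K : Type*) [Field K] where
  line : Submodule K (Fin 3 → K)
  finrank_line : Module.finrank K line = 2
  not_mem : ∀ p ∈ conic K, ¬ p.submodule ≤ line

variable {K : Type*} [Field K]

theorem mk_mem_conic_iff {v : Fin 3 → K} (hv : v ≠ 0) :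
    Projectivization.mk K v hv ∈ conic K ↔ v 1 ^ 2 = v 0 * v 2 := by
  obtain ⟨a, ha⟩ := Projectivization.exists_smul_eq_mk_rep K v hv
  have h0 : (a : K) ≠ 0 := a.ne_zero
  have h : ∀ i, (Projectivization.mk K v hv).rep i = a * v i := fun i => by
    rw [← ha]; rfl
  simp only [conic, Set.mem_ofPred_eq, h]
  constructor
  · intro e
    have : (a : K) ^ 2 * (v 1 ^ 2 - v 0 * v 2) = 0 := by linear_combination e
    rcases mul_eq_zero.1 this with h' | h'
    · exact absurd h' (pow_ne_zero 2 h0)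
    · linear_combination h'
  · intro e
    linear_combination (a : K) ^ 2 * e

/-- The matrix that takes `(s ^ 2, s t, t ^ 2)` to `(s' ^ 2, s' t', t' ^ 2)`, where
`(s', t') = g (s, t)`. -/
def symSq (g : Matrix (Fin 2) (Fin 2) K) : Matrix (Fin 3) (Fin 3) K :=
  !![g 0 0 ^ 2, 2 * g 0 0 * g 0 1, g 0 1 ^ 2;
    g 0 0 * g 1 0, g 0 0 * g 1 1 + g 0 1 * g 1 0, g 0 1 * g 1 1;
    g 1 0 ^ 2, 2 * g 1 0 * g 1 1, g 1 1 ^ 2]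

/-- The homomorphism from `SL_2` to `GL_3` given by `symSq`. -/
def slHom (K : Type*) [Field K] : Matrix.SpecialLinearGroup (Fin 2) K →* GL (Fin 3) K :=
  MonoidHom.toHomUnits
    { toFun := fun g => symSq g.1
      map_one' := by
        ext i j; fin_cases i <;> fin_cases j <;> simp [symSq]
      map_mul' := fun g h => by
        ext i j
        fin_cases i <;> fin_cases j <;>
          simp [symSq, Matrix.mul_apply, Fin.sum_univ_succ] <;> ring }

/-- The induced homomorphism from `PSL_2` to `GL_3`. -/
def pslHom (K : Type*) [Field K] :
    Matrix.ProjectiveSpecialLinearGroup (Fin 2) K →* GL (Fin 3) K :=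
  QuotientGroup.lift _ (slHom K) (by
    intro g hg
    obtain ⟨r, hr, hg⟩ := Matrix.SpecialLinearGroup.mem_center_iff.1 hg
    have hr' : r ^ 2 = 1 := by simpa using hr
    rw [MonoidHom.mem_ker]
    ext i j
    change symSq g.1 i j = (1 : Matrix (Fin 3) (Fin 3) K) i j
    rw [← hg]
    fin_cases i <;> fin_cases j <;> simp [symSq, ← sq, hr'])

/-- The group `PSL_2` permutes the points of the conic. -/
theorem pslHom_mulVec_conic (g : Matrix.ProjectiveSpecialLinearGroup (Fin 2) K)
    {v : Fin 3 → K} (h : v 1 ^ 2 = v 0 * v 2) :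
    ((pslHom K g).1.mulVec v) 1 ^ 2 = ((pslHom K g).1.mulVec v) 0 * ((pslHom K g).1.mulVec v) 2 := by
  induction g using QuotientGroup.induction_on with
  | H g =>
    change ((symSq g.1).mulVec v) 1 ^ 2 = ((symSq g.1).mulVec v) 0 * ((symSq g.1).mulVec v) 2
    have hd := g.2
    rw [Matrix.det_fin_two] at hd
    simp only [symSq, Matrix.mulVec, dotProduct, Fin.sum_univ_succ]
    simp
    linear_combination (g.1 0 0 * g.1 1 1 - g.1 0 1 * g.1 1 0) ^ 2 * h

/-- The linear automorphism of `K ^ 3` by which an element of `PSL_2` acts on the plane. -/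
def toLin (g : Matrix.ProjectiveSpecialLinearGroup (Fin 2) K) :
    (Fin 3 → K) →ₗ[K] (Fin 3 → K) :=
  Matrix.toLin' (pslHom K g).1

theorem toLin_one : toLin (1 : Matrix.ProjectiveSpecialLinearGroup (Fin 2) K) = LinearMap.id := by
  simp [toLin]

theorem toLin_mul (g h : Matrix.ProjectiveSpecialLinearGroup (Fin 2) K) :
    toLin (g * h) = toLin g ∘ₗ toLin h := by
  simp [toLin, Matrix.toLin'_mul]

theorem toLin_inv_apply (g : Matrix.ProjectiveSpecialLinearGroup (Fin 2) K) (v : Fin 3 → K) :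
    toLin g⁻¹ (toLin g v) = v := by
  rw [← LinearMap.comp_apply, ← toLin_mul, inv_mul_cancel, toLin_one, LinearMap.id_apply]

/-- `PSL_2` acts on the external lines to the conic: `g` sends a line to its image. -/
instance : MulAction (Matrix.ProjectiveSpecialLinearGroup (Fin 2) K) (ExternalLine K) where
  smul g l := ⟨l.line.map (toLin g), by
    rw [← l.finrank_line]
    exact (Submodule.equivMapOfInjective _
      (Function.LeftInverse.injective (toLin_inv_apply g)) l.line).finrank_eq.symm, fun p hp hle => by
    induction p using Projectivization.ind with
      | h v hv =>
        rw [Projectivization.submodule_mk, Submodule.span_singleton_le_iff_mem] at hle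
        obtain ⟨w, hw, rfl⟩ := hle
        have hw0 : w ≠ 0 := fun h => hv (by rw [h, map_zero])
        refine l.not_mem (Projectivization.mk K w hw0) ?_ ?_
        · rw [mk_mem_conic_iff] at hp ⊢
          have := pslHom_mulVec_conic g⁻¹ hp
          rw [← Matrix.toLin'_apply] at this
          change (toLin g⁻¹ (toLin g w)) 1 ^ 2 = (toLin g⁻¹ (toLin g w)) 0 *
            (toLin g⁻¹ (toLin g w)) 2 at this
          rwa [toLin_inv_apply] at this
        · rwa [Projectivization.submodule_mk, Submodule.span_singleton_le_iff_mem]⟩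
  one_smul l := ExternalLine.ext (by
    change l.line.map (toLin 1) = l.line
    rw [toLin_one, Submodule.map_id])
  mul_smul g h l := ExternalLine.ext (by
    change l.line.map (toLin (g * h)) = (l.line.map (toLin h)).map (toLin g)
    rw [toLin_mul, Submodule.map_comp])

end Conic

/-- The map from the dihedral group given by a rotation `x` and a reflection `y`. -/
def DihedralGroup.lift {H : Type*} [Group H] {m : ℕ} (x y : H) (hx : x ^ m = 1) (hy : y * y = 1)
    (hxy : x * y = y * x⁻¹) : DihedralGroup m →* H :=
  let f : Multiplicative (ZMod m) →* H := AddMonoidHom.toMultiplicativeLeft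
    (ZMod.lift m ⟨(zmultiplesHom (Additive H)) (Additive.ofMul x), by
      simp [← ofMul_pow, hx]⟩)
  have key : ∀ i, f i * y = y * (f i)⁻¹ := by
    intro i
    obtain ⟨k, hk⟩ := ZMod.intCast_surjective (Multiplicative.toAdd i)
    have hf : f i = x ^ k := by
      change Additive.toMul (ZMod.lift m _ (Multiplicative.toAdd i)) = _
      rw [← hk, ZMod.lift_coe]
      simp
    have h : SemiconjBy y x⁻¹ x := hxy.symm
    rw [hf, ← inv_zpow]
    exact (h.zpow_right k).symm
  have hcomm : ∀ i j, f i * f j = f j * f i := fun i j => by rw [← map_mul, mul_comm, map_mul]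
  { toFun := fun d => match d with
      | .r i => f (Multiplicative.ofAdd i)
      | .sr i => y * f (Multiplicative.ofAdd i)
    map_one' := map_one f
    map_mul' := by
      rintro (i | i) (j | j)
      · exact map_mul f _ _
      · change y * f (Multiplicative.ofAdd j / Multiplicative.ofAdd i) = f _ * (y * f _)
        rw [← mul_assoc, key, map_div, mul_assoc, div_eq_mul_inv, ← map_inv, hcomm]
      · change y * f (Multiplicative.ofAdd (i + j)) = y * f _ * f _
        rw [ofAdd_add, map_mul, mul_assoc]
      · change f (Multiplicative.ofAdd j / Multiplicative.ofAdd i) = y * f _ * (y * f _)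
        rw [mul_assoc, ← mul_assoc (f _) y, key, mul_assoc y, ← mul_assoc y y, hy, one_mul,
          map_div, div_eq_mul_inv, ← map_inv, hcomm] }

/-- A group generated by a cyclic subgroup of order `m` and an involution outside it that inverts
it is dihedral. -/
theorem DihedralGroup.nonempty_mulEquiv {H : Type*} [Group H] {m : ℕ} (x y : H)
    (hx : orderOf x = m) (hy : y * y = 1) (hxy : x * y = y * x⁻¹)
    (hy' : y ∉ Subgroup.zpowers x)
    (h : ∀ g : H, g ∈ Subgroup.zpowers x ∨ g * y ∈ Subgroup.zpowers x) :
    Nonempty (H ≃* DihedralGroup m) := by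
  let F := DihedralGroup.lift x y (hx ▸ pow_orderOf_eq_one x) hy hxy
  have hr : ∀ k : ℤ, F (.r (k : ZMod m)) = x ^ k := by
    intro k
    rw [← DihedralGroup.r_one_zpow, map_zpow]
    congr 1
    have h : (zmultiplesHom (Additive H)) (Additive.ofMul x) m = 0 := by
      simp [← ofMul_pow, ← hx, pow_orderOf_eq_one]
    change Additive.toMul (ZMod.lift m ⟨_, h⟩ (1 : ZMod m)) = x
    rw [← Int.cast_one, ZMod.lift_coe]
    simp
  have hsr : ∀ k : ℤ, F (.sr (k : ZMod m)) = y * x ^ k := fun k => by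
    rw [← hr]
    rfl
  refine ⟨(MulEquiv.ofBijective F ⟨?_, ?_⟩).symm⟩
  · rw [injective_iff_map_eq_one]
    rintro (i | i) hi <;> obtain ⟨k, rfl⟩ := ZMod.intCast_surjective i
    · rw [hr, ← orderOf_dvd_iff_zpow_eq_one, hx] at hi
      rw [(ZMod.intCast_zmod_eq_zero_iff_dvd k m).2 hi, DihedralGroup.r_zero]
    · rw [hsr] at hi
      refine absurd ?_ hy'
      rw [eq_inv_of_mul_eq_one_left hi]
      exact inv_mem (Subgroup.zpow_mem_zpowers x k)
  · intro g
    have h : g ∈ Subgroup.zpowers x ∨ y * g ∈ Subgroup.zpowers x := by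
      rw [← inv_mem_iff (x := g), ← inv_mem_iff (x := y * g), mul_inv_rev,
        inv_eq_of_mul_eq_one_left hy]
      exact h g⁻¹
    rcases h with ⟨k, hk⟩ | ⟨k, hk⟩
    · exact ⟨_, (hr k).trans hk⟩
    · refine ⟨_, (hsr k).trans ?_⟩
      change x ^ k = _ at hk
      rw [hk, ← mul_assoc, hy, one_mul]

/-- The elements of norm `1` in a quadratic extension of a finite field of characteristic `2`. -/
theorem QuadraticAlgebra.card_ker_norm {K : Type*} [Field K] [Finite K] [CharP K 2] (c b : K)
    [Fact (∀ r : K, r ^ 2 ≠ c + b * r)] :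
    Nat.card (Units.map (QuadraticAlgebra.norm (R := K) (a := c) (b := b))).ker = Nat.card K + 1 := by
  have : Finite (QuadraticAlgebra K c b) := Finite.of_equiv _ (QuadraticAlgebra.equivProd c b).symm
  set N := Units.map (QuadraticAlgebra.norm (R := K) (a := c) (b := b)) with hN
  have hsurj : Function.Surjective N := by
    intro k
    obtain ⟨r, hr⟩ := (frobeniusEquiv K 2).surjective k
    rw [frobeniusEquiv_apply, frobenius_def] at hr
    have hr0 : r ≠ 0 := by
      rintro rfl
      exact k.ne_zero (by rw [← hr]; simp)
    refine ⟨Units.map (algebraMap K (QuadraticAlgebra K c b)) (Units.mk0 r hr0), ?_⟩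
    ext
    simp [hN, hr]
  have h1 := N.ker.card_mul_index
  rw [Subgroup.index_ker, MonoidHom.range_eq_top.2 hsurj, Subgroup.card_top, Nat.card_units,
    Nat.card_units, Nat.card_congr (QuadraticAlgebra.equivProd c b), Nat.card_prod] at h1
  have hq : 1 < Nat.card K := Finite.one_lt_card
  obtain ⟨k, hk⟩ : ∃ k, Nat.card K = k + 1 := ⟨Nat.card K - 1, by omega⟩
  rw [hk] at h1 ⊢
  have h2 : (k + 1) * (k + 1) - 1 = (k + 1 + 1) * k := by
    have : (k + 1) * (k + 1) = (k + 1 + 1) * k + 1 := by ring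
    omega
  rw [h2, Nat.add_sub_cancel] at h1
  exact Nat.eq_of_mul_eq_mul_right (by omega) h1

namespace Conic

open MulAction
open scoped MatrixGroups

section Lines

variable {K : Type*} [Field K]

/-- The linear form `a x + y + c z`. -/
def lineForm (a c : K) : (Fin 3 → K) →ₗ[K] K :=
  a • LinearMap.proj 0 + LinearMap.proj 1 + c • LinearMap.proj 2

theorem lineForm_apply (a c : K) (v : Fin 3 → K) :
    lineForm a c v = a * v 0 + v 1 + c * v 2 := rfl

theorem ker_lineForm_inj {a c a' c' : K} :
    LinearMap.ker (lineForm a c) = LinearMap.ker (lineForm a' c') ↔ a = a' ∧ c = c' := by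
  refine ⟨fun h => ?_, by rintro ⟨rfl, rfl⟩; rfl⟩
  have key : ∀ v : Fin 3 → K, a * v 0 + v 1 + c * v 2 = 0 → a' * v 0 + v 1 + c' * v 2 = 0 := by
    intro v hv
    have : v ∈ LinearMap.ker (lineForm a c) := hv
    rwa [h] at this
  have ha := key ![1, -a, 0] (by simp)
  have hc := key ![0, -c, 1] (by simp)
  simp at ha hc
  exact ⟨by linear_combination -ha, by linear_combination -hc⟩

theorem finrank_ker_of_ne_zero {f : (Fin 3 → K) →ₗ[K] K} (hf : f ≠ 0) :
    Module.finrank K (LinearMap.ker f) = 2 := by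
  have h := f.finrank_range_add_finrank_ker
  rw [LinearMap.range_eq_top.2 (LinearMap.surjective hf), finrank_top] at h
  simp at h
  omega

theorem linearMap_apply (f : (Fin 3 → K) →ₗ[K] K) (v : Fin 3 → K) :
    f v = f (Pi.single 0 1) * v 0 + f (Pi.single 1 1) * v 1 + f (Pi.single 2 1) * v 2 := by
  have h : v = v 0 • Pi.single 0 1 + v 1 • Pi.single 1 1 + v 2 • Pi.single 2 1 := by
    ext i
    fin_cases i <;> simp
  conv_lhs => rw [h]
  simp [mul_comm]

variable [CharP K 2]

/-- The line `a x + y + c z = 0`, which is external when `a c` is not of the form `u ^ 2 + u`. -/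
def mkLine (x : {x : K × K // ∀ u, u ^ 2 + u ≠ x.1 * x.2}) : ExternalLine K where
  line := LinearMap.ker (lineForm x.1.1 x.1.2)
  finrank_line := finrank_ker_of_ne_zero fun h => by
    have := LinearMap.congr_fun h ![0, 1, 0]
    simp [lineForm_apply] at this
  not_mem p hp hle := by
    obtain ⟨⟨a, c⟩, hx⟩ := x
    induction p using Projectivization.ind with
    | h v hv =>
      rw [Projectivization.submodule_mk, Submodule.span_singleton_le_iff_mem, LinearMap.mem_ker,
        lineForm_apply] at hle
      rw [mk_mem_conic_iff] at hp
      simp only at hle hx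
      have h2 : (2 : K) = 0 := CharTwo.two_eq_zero
      by_cases h : v 2 = 0
      · have h1 : v 1 = 0 := by simpa [h] using hp
        have h0 : v 0 ≠ 0 := fun h0 => hv (by ext i; fin_cases i <;> assumption)
        have ha : a = 0 := by simpa [h, h1, h0] using hle
        exact hx 0 (by simp [ha])
      · refine hx (a * v 1 / v 2) ?_
        field_simp
        linear_combination a ^ 2 * hp + a * v 2 * hle - a * c * v 2 ^ 2 * h2

theorem mem_mkLine {x : {x : K × K // ∀ u, u ^ 2 + u ≠ x.1 * x.2}} {v : Fin 3 → K} :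
    v ∈ (mkLine x).line ↔ x.1.1 * v 0 + v 1 + x.1.2 * v 2 = 0 := Iff.rfl

theorem mkLine_injective : Function.Injective (mkLine (K := K)) := fun _ _ h =>
  Subtype.ext (Prod.ext_iff.2 (ker_lineForm_inj.1 (congrArg ExternalLine.line h)))

variable [Finite K]

theorem mkLine_surjective : Function.Surjective (mkLine (K := K)) := by
  intro l
  have h2 : (2 : K) = 0 := CharTwo.two_eq_zero
  have sqrt : ∀ k : K, ∃ r, r ^ 2 = k := fun k => by
    obtain ⟨r, hr⟩ := (frobeniusEquiv K 2).surjective k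
    exact ⟨r, by rw [← hr, frobeniusEquiv_apply, frobenius_def]⟩
  have hlt : l.line < ⊤ := by
    refine lt_top_iff_ne_top.2 fun h => ?_
    have := l.finrank_line
    rw [h, finrank_top] at this
    simp at this
  obtain ⟨f, hf, hle⟩ := Submodule.exists_le_ker_of_lt_top l.line hlt
  have hl : l.line = LinearMap.ker f :=
    Submodule.eq_of_le_of_finrank_eq hle (by rw [l.finrank_line, finrank_ker_of_ne_zero hf])
  have hext : ∀ s t : K, (s ≠ 0 ∨ t ≠ 0) →
      f (Pi.single 0 1) * s ^ 2 + f (Pi.single 1 1) * (s * t) + f (Pi.single 2 1) * t ^ 2 ≠ 0 := by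
    intro s t hst h
    have hv : ![s ^ 2, s * t, t ^ 2] ≠ 0 := by
      intro h
      have h0 := congr_fun h 0
      have h1 := congr_fun h 2
      simp at h0 h1
      tauto
    refine l.not_mem (Projectivization.mk K _ hv) ?_ ?_
    · rw [mk_mem_conic_iff]
      simp
      ring
    · rw [Projectivization.submodule_mk, Submodule.span_singleton_le_iff_mem, hl,
        LinearMap.mem_ker, linearMap_apply]
      simpa using h
  set a := f (Pi.single 0 1) with ha
  set b := f (Pi.single 1 1) with hb
  set c := f (Pi.single 2 1) with hc
  have hb0 : b ≠ 0 := by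
    intro hb0
    obtain ⟨s, hs⟩ := sqrt a
    obtain ⟨t, ht⟩ := sqrt c
    by_cases h : s = 0
    · refine hext 1 0 (by simp) ?_
      simp [← hs, h]
    · refine hext t s (Or.inr h) ?_
      rw [hb0, ← hs, ← ht]
      linear_combination s ^ 2 * t ^ 2 * h2
  refine ⟨⟨(a / b, c / b), fun u hu => ?_⟩, ?_⟩
  · have ha0 : a ≠ 0 := fun h => hext 1 0 (by simp) (by simp [h])
    refine hext (b * u / a) 1 (by simp) ?_
    simp only at hu
    field_simp at hu ⊢
    linear_combination hu + a * c * h2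
  · ext v
    rw [mem_mkLine, hl, LinearMap.mem_ker, linearMap_apply f v, ← ha, ← hb, ← hc]
    have h : a * v 0 + b * v 1 + c * v 2 = b * (a / b * v 0 + v 1 + c / b * v 2) := by
      field_simp
    rw [h, mul_eq_zero, or_iff_right hb0]

end Lines

section ArtinSchreier

variable (K : Type*) [Field K] [CharP K 2]

/-- The additive map `u ↦ u ^ 2 + u` in characteristic `2`. -/
def artinSchreier : K →+ K where
  toFun u := u ^ 2 + u
  map_zero' := by simp
  map_add' u v := by
    rw [CharTwo.add_sq]
    ring

theorem artinSchreier_apply (u : K) : artinSchreier K u = u ^ 2 + u := rfl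

theorem eq_zero_or_one_of_sq_add_self {u : K} (h : u ^ 2 + u = 0) : u = 0 ∨ u = 1 := by
  have : u * (u + 1) = 0 := by linear_combination h
  exact (mul_eq_zero.1 this).imp_right CharTwo.add_eq_zero.1

theorem card_ker_artinSchreier : Nat.card (artinSchreier K).ker = 2 := by
  have : ((artinSchreier K).ker : Set K) = {0, 1} := by
    ext u
    simp only [SetLike.mem_coe, AddMonoidHom.mem_ker, artinSchreier_apply, Set.mem_insert_iff,
      Set.mem_singleton_iff]
    refine ⟨eq_zero_or_one_of_sq_add_self K, ?_⟩
    rintro (rfl | rfl)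
    · simp
    · rw [one_pow, CharTwo.add_self_eq_zero]
  change Nat.card ((artinSchreier K).ker : Set K) = 2
  rw [this, Nat.card_coe_set_eq, Set.ncard_pair zero_ne_one]

theorem two_mul_card_range_artinSchreier :
    2 * Nat.card (artinSchreier K).range = Nat.card K := by
  rw [← card_ker_artinSchreier K, ← AddSubgroup.index_ker, AddSubgroup.card_mul_index]

variable [Finite K]

theorem index_range_artinSchreier : (artinSchreier K).range.index = 2 := by
  have h := (artinSchreier K).range.card_mul_index
  rw [← two_mul_card_range_artinSchreier K, mul_comm] at h
  exact Nat.eq_of_mul_eq_mul_right Nat.card_pos h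

theorem card_externalLine : Nat.card (ExternalLine K) = (Nat.card K).choose 2 := by
  rw [← Nat.card_congr (Equiv.ofBijective _ ⟨mkLine_injective, mkLine_surjective⟩)]
  let e : {x : K × K // ∀ u, u ^ 2 + u ≠ x.1 * x.2} ≃
      Kˣ × (((artinSchreier K).range : Set K)ᶜ : Set K) :=
    { toFun := fun x => (Units.mk0 x.1.1 fun h => x.2 0 (by simp [h]),
        ⟨x.1.1 * x.1.2, by rintro ⟨u, hu⟩; exact x.2 u hu⟩)
      invFun := fun y => ⟨(y.1, (y.1⁻¹ : Kˣ) * y.2.1), fun u hu => y.2.2 ⟨u, by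
        rw [artinSchreier_apply, hu, Units.mul_inv_cancel_left]⟩⟩
      left_inv := fun x => by
        have h : x.1.1 ≠ 0 := fun h => x.2 0 (by simp [h])
        ext <;> simp [h]
      right_inv := fun y => by
        ext <;> simp }
  have h := two_mul_card_range_artinSchreier K
  have h2 : Nat.card (((artinSchreier K).range : Set K)ᶜ : Set K) =
      Nat.card (artinSchreier K).range := by
    have := Set.ncard_add_ncard_compl ((artinSchreier K).range : Set K)
    rw [← Nat.card_coe_set_eq, ← Nat.card_coe_set_eq] at this
    change Nat.card (artinSchreier K).range + _ = _ at this
    omega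
  rw [Nat.card_congr e, Nat.card_prod, Nat.card_units, h2, Nat.choose_two_right, ← h]
  set m := Nat.card (artinSchreier K).range
  rw [mul_assoc, Nat.mul_div_cancel_left _ two_pos, mul_comm]

end ArtinSchreier

section Action

variable {K : Type*} [Field K]

theorem mem_inv_smul_line (g : SL(2, K)) (l : ExternalLine K)
    (v : Fin 3 → K) :
    v ∈ ((g : PSL(2, K))⁻¹ • l).line ↔
      (symSq g.1).mulVec v ∈ l.line := by
  change v ∈ l.line.map (toLin (g : PSL(2, K))⁻¹) ↔
    toLin (g : PSL(2, K)) v ∈ l.line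
  constructor
  · rintro ⟨w, hw, rfl⟩
    have := toLin_inv_apply (g : PSL(2, K))⁻¹ w
    rw [inv_inv] at this
    rwa [this]
  · exact fun h => ⟨_, h, toLin_inv_apply _ _⟩

/-- The upper unitriangular matrices. -/
def shift (u : K) : SL(2, K) := ⟨!![1, u; 0, 1], by simp⟩

theorem shift_mul (u v : K) : shift u * shift v = shift (u + v) := by
  ext i j
  rw [Matrix.SpecialLinearGroup.coe_mul]
  fin_cases i <;> fin_cases j <;> simp [shift, Matrix.mul_apply, add_comm]

variable [CharP K 2]

theorem inv_smul_mkLine_eq_iff (g : SL(2, K))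
    (x y : {x : K × K // ∀ u, u ^ 2 + u ≠ x.1 * x.2}) :
    (g : PSL(2, K))⁻¹ • mkLine x = mkLine y ↔
      x.1.1 * g.1 0 0 ^ 2 + g.1 0 0 * g.1 1 0 + x.1.2 * g.1 1 0 ^ 2 = y.1.1 ∧
      x.1.1 * g.1 0 1 ^ 2 + g.1 0 1 * g.1 1 1 + x.1.2 * g.1 1 1 ^ 2 = y.1.2 := by
  have h2 : (2 : K) = 0 := CharTwo.two_eq_zero
  have hd := g.2
  rw [Matrix.det_fin_two] at hd
  rw [← ker_lineForm_inj, ExternalLine.ext_iff]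
  refine Eq.congr ?_ rfl
  ext v
  rw [mem_inv_smul_line, mem_mkLine, LinearMap.mem_ker, lineForm_apply]
  simp only [symSq, Matrix.mulVec, dotProduct, Fin.sum_univ_three]
  simp only [h2, Matrix.of_apply, Matrix.cons_val]
  refine Eq.congr ?_ rfl
  linear_combination v 1 * hd + g.1 0 1 * g.1 1 0 * v 1 * h2

theorem mem_stabilizer_mkLine_iff (g : SL(2, K))
    (x : {x : K × K // ∀ u, u ^ 2 + u ≠ x.1 * x.2}) :
    (g : PSL(2, K)) ∈
        stabilizer PSL(2, K) (mkLine x) ↔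
      x.1.1 * g.1 0 0 ^ 2 + g.1 0 0 * g.1 1 0 + x.1.2 * g.1 1 0 ^ 2 = x.1.1 ∧
      x.1.1 * g.1 0 1 ^ 2 + g.1 0 1 * g.1 1 1 + x.1.2 * g.1 1 1 ^ 2 = x.1.2 := by
  rw [← inv_smul_mkLine_eq_iff, ← inv_mem_iff, mem_stabilizer_iff]

theorem mk_injective : Function.Injective
    ((↑) : SL(2, K) → PSL(2, K)) := by
  change Function.Injective (QuotientGroup.mk' (Subgroup.center SL(2, K)))
  rw [← MonoidHom.ker_eq_bot_iff, QuotientGroup.ker_mk', eq_bot_iff]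
  intro g hg
  obtain ⟨r, hr, hg⟩ := Matrix.SpecialLinearGroup.mem_center_iff.1 hg
  have hr' : r = 1 := by
    rw [Fintype.card_fin] at hr
    have : (r + 1) ^ 2 = 0 := by
      rw [CharTwo.add_sq, hr, one_pow, CharTwo.add_self_eq_zero]
    exact CharTwo.add_eq_zero.1 (pow_eq_zero_iff two_ne_zero |>.1 this)
  rw [Subgroup.mem_bot]
  ext i j
  rw [← hg, hr']
  simp

variable (K) in
/-- The unipotent radical of a Borel subgroup of `PSL_2`. -/
def unipotent : Multiplicative K →* PSL(2, K) :=
  (QuotientGroup.mk' _).comp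
    { toFun := fun u => shift (Multiplicative.toAdd u)
      map_one' := by ext i j; fin_cases i <;> fin_cases j <;> simp [shift]
      map_mul' := fun _ _ => (shift_mul _ _).symm }

theorem card_range_unipotent : Nat.card (unipotent K).range = Nat.card K := by
  refine (Nat.card_congr (MonoidHom.ofInjective (f := unipotent K) fun u v h => ?_).toEquiv).symm
  have : shift (Multiplicative.toAdd u) = shift (Multiplicative.toAdd v) := mk_injective h
  simpa [shift] using congrArg (fun g => g.1 0 1) this

variable [Finite K]

theorem isPretransitive :
    IsPretransitive PSL(2, K) (ExternalLine K) := by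
  refine ⟨fun l m => ?_⟩
  obtain ⟨⟨⟨a, c⟩, hx⟩, rfl⟩ := mkLine_surjective l
  obtain ⟨⟨⟨a', c'⟩, hy⟩, rfl⟩ := mkLine_surjective m
  simp only at hx hy
  have ha : a ≠ 0 := fun h => hx 0 (by simp [h])
  have ha' : a' ≠ 0 := fun h => hy 0 (by simp [h])
  obtain ⟨d, hd⟩ := (frobeniusEquiv K 2).surjective (a' / a)
  rw [frobeniusEquiv_apply, frobenius_def] at hd
  have hd0 : d ≠ 0 := by
    rintro rfl
    rw [zero_pow two_ne_zero] at hd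
    exact div_ne_zero ha' ha hd.symm
  obtain ⟨w, hw⟩ : a * c + a' * c' ∈ (artinSchreier K).range := by
    rw [AddSubgroup.add_mem_iff_of_index_two (index_range_artinSchreier K)]
    exact iff_of_false (fun ⟨u, hu⟩ => hx u hu) (fun ⟨u, hu⟩ => hy u hu)
  rw [artinSchreier_apply] at hw
  have h2 : (2 : K) = 0 := CharTwo.two_eq_zero
  have hd' : a * d ^ 2 = a' := by
    rw [hd]
    field_simp
  refine ⟨_, (inv_smul_mkLine_eq_iff ⟨!![d, w / (a * d); 0, d⁻¹], by simp [hd0]⟩ _ _).2 ⟨?_, ?_⟩⟩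
  · simpa using hd'
  · simp
    refine mul_left_cancel₀ ha' ?_
    rw [← hd'] at hw ⊢
    field_simp
    linear_combination hw + a * c * h2

end Action

section Stabilizer

variable {K : Type*} [Field K] {c : K}

theorem norm_eq_one (u : (Units.map (QuadraticAlgebra.norm (R := K) (a := c) (b := 1))).ker) :
    u.1.1.re ^ 2 + u.1.1.re * u.1.1.im - c * u.1.1.im ^ 2 = 1 := by
  have h : QuadraticAlgebra.norm u.1.1 = 1 := congrArg Units.val u.2
  rw [QuadraticAlgebra.norm_def] at h
  linear_combination h

/-- Multiplication by an element of norm `1` of a quadratic extension, as a matrix. -/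
def normOneMatrix (u : (Units.map (QuadraticAlgebra.norm (R := K) (a := c) (b := 1))).ker) :
    SL(2, K) :=
  ⟨!![u.1.1.re, c * u.1.1.im; u.1.1.im, u.1.1.re + u.1.1.im], by
    rw [Matrix.det_fin_two_of]
    linear_combination norm_eq_one u⟩

theorem coe_normOneMatrix (u : (Units.map (QuadraticAlgebra.norm (R := K) (a := c) (b := 1))).ker) :
    (normOneMatrix u).1 = !![u.1.1.re, c * u.1.1.im; u.1.1.im, u.1.1.re + u.1.1.im] := rfl

/-- The embedding in `SL_2` of the elements of norm `1` of a quadratic extension. -/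
def normOneHom (c : K) :
    (Units.map (QuadraticAlgebra.norm (R := K) (a := c) (b := 1))).ker →* SL(2, K) where
  toFun := normOneMatrix
  map_one' := by
    ext i j
    rw [coe_normOneMatrix]
    fin_cases i <;> fin_cases j <;> simp [QuadraticAlgebra.re_one, QuadraticAlgebra.im_one]
  map_mul' u v := by
    ext i j
    rw [Matrix.SpecialLinearGroup.coe_mul, coe_normOneMatrix, coe_normOneMatrix, coe_normOneMatrix]
    fin_cases i <;> fin_cases j <;> simp [Matrix.mul_apply] <;> ring

theorem coe_normOneHom (u : (Units.map (QuadraticAlgebra.norm (R := K) (a := c) (b := 1))).ker) :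
    (normOneHom c u).1 = !![u.1.1.re, c * u.1.1.im; u.1.1.im, u.1.1.re + u.1.1.im] := rfl

theorem mem_range_normOneHom {g : SL(2, K)}
    (h : g.1 0 0 ^ 2 + g.1 0 0 * g.1 1 0 - c * g.1 1 0 ^ 2 = 1)
    (h1 : g.1 0 1 = c * g.1 1 0) (h2 : g.1 1 1 = g.1 0 0 + g.1 1 0) :
    g ∈ (normOneHom c).range := by
  have hn : QuadraticAlgebra.norm (⟨g.1 0 0, g.1 1 0⟩ : QuadraticAlgebra K c 1) = 1 := by
    rw [QuadraticAlgebra.norm_def]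
    linear_combination h
  have hu : IsUnit (⟨g.1 0 0, g.1 1 0⟩ : QuadraticAlgebra K c 1) := by
    rw [QuadraticAlgebra.isUnit_iff_norm_isUnit, hn]
    exact isUnit_one
  refine ⟨⟨hu.unit, Units.ext hn⟩, ?_⟩
  ext i j
  rw [coe_normOneHom]
  fin_cases i <;> fin_cases j <;> simp [h1, h2]

theorem normOneHom_injective : Function.Injective (normOneHom c) := by
  intro u v h
  have h := congrArg Subtype.val h
  rw [coe_normOneHom, coe_normOneHom] at h
  refine Subtype.ext (Units.ext (QuadraticAlgebra.ext ?_ ?_))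
  · simpa using congr_fun₂ h 0 0
  · simpa using congr_fun₂ h 1 0

theorem shift_one_notMem : shift (1 : K) ∉ (normOneHom c).range := by
  rintro ⟨u, hu⟩
  have h := congrArg Subtype.val hu
  rw [coe_normOneHom] at h
  have h1 := congr_fun₂ h 0 1
  have h2 := congr_fun₂ h 1 0
  simp [shift] at h1 h2
  simp [h2] at h1

variable [CharP K 2]

theorem normOneHom_mul_shift
    (u : (Units.map (QuadraticAlgebra.norm (R := K) (a := c) (b := 1))).ker) :
    normOneHom c u * shift 1 = shift 1 * (normOneHom c u)⁻¹ := by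
  have h2 : (2 : K) = 0 := CharTwo.two_eq_zero
  ext i j
  rw [Matrix.SpecialLinearGroup.coe_mul, Matrix.SpecialLinearGroup.coe_mul,
    Matrix.SpecialLinearGroup.coe_inv, coe_normOneHom, Matrix.adjugate_fin_two_of]
  fin_cases i <;> fin_cases j <;> simp [shift, Matrix.mul_apply]
  · linear_combination c * u.1.1.im * h2
  · linear_combination u.1.1.im * h2
  · linear_combination u.1.1.im * h2

theorem shift_one_mul_self : shift (1 : K) * shift 1 = 1 := by
  rw [shift_mul, CharTwo.add_self_eq_zero]
  ext i j
  fin_cases i <;> fin_cases j <;> simp [shift]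

theorem normOneHom_mem_stabilizer (hc : ∀ u : K, u ^ 2 + u ≠ 1 * c)
    (u : (Units.map (QuadraticAlgebra.norm (R := K) (a := c) (b := 1))).ker) :
    (normOneHom c u : PSL(2, K)) ∈ stabilizer PSL(2, K) (mkLine ⟨(1, c), hc⟩) := by
  have h2 : (2 : K) = 0 := CharTwo.two_eq_zero
  have h := norm_eq_one u
  rw [mem_stabilizer_mkLine_iff, coe_normOneHom]
  simp
  constructor
  · linear_combination h + c * u.1.1.im ^ 2 * h2
  · linear_combination c * h + (c * u.1.1.re * u.1.1.im + c ^ 2 * u.1.1.im ^ 2 +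
      c * u.1.1.im ^ 2) * h2

theorem shift_one_mem_stabilizer (hc : ∀ u : K, u ^ 2 + u ≠ 1 * c) :
    ((shift 1 : SL(2, K)) : PSL(2, K)) ∈ stabilizer PSL(2, K) (mkLine ⟨(1, c), hc⟩) := by
  have h2 : (2 : K) = 0 := CharTwo.two_eq_zero
  rw [mem_stabilizer_mkLine_iff]
  simp [shift]
  linear_combination h2

theorem mem_range_normOneHom_or (hc : ∀ u : K, u ^ 2 + u ≠ 1 * c) (g : SL(2, K))
    (hg : (g : PSL(2, K)) ∈ stabilizer PSL(2, K) (mkLine ⟨(1, c), hc⟩)) :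
    g ∈ (normOneHom c).range ∨ g * shift 1 ∈ (normOneHom c).range := by
  have h2 : (2 : K) = 0 := CharTwo.two_eq_zero
  rw [mem_stabilizer_mkLine_iff] at hg
  have hdet := g.2
  rw [Matrix.det_fin_two] at hdet
  have hs : (g * shift 1).1 = !![g.1 0 0, g.1 0 0 + g.1 0 1; g.1 1 0, g.1 1 0 + g.1 1 1] := by
    rw [Matrix.SpecialLinearGroup.coe_mul]
    ext i j
    fin_cases i <;> fin_cases j <;> simp [shift, Matrix.mul_apply]
  obtain ⟨h1, h3⟩ := hg
  simp only [one_mul] at h1 h3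
  have hn : g.1 0 0 ^ 2 + g.1 0 0 * g.1 1 0 - c * g.1 1 0 ^ 2 = 1 := by
    linear_combination h1 - c * g.1 1 0 ^ 2 * h2
  obtain ⟨k, hk⟩ : ∃ k, k = (g.1 0 0 + g.1 1 0) * g.1 0 1 - c * g.1 1 0 * g.1 1 1 := ⟨_, rfl⟩
  have hq : g.1 0 1 = g.1 0 0 * k + c * g.1 1 0 := by
    rw [hk]
    linear_combination c * g.1 1 0 * hdet - g.1 0 1 * hn
  have ht : g.1 1 1 = g.1 1 0 * k + (g.1 0 0 + g.1 1 0) := by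
    rw [hk]
    linear_combination (g.1 0 0 + g.1 1 0) * hdet - g.1 1 1 * hn
  have hk0 : k ^ 2 + k = 0 := by
    rw [hq, ht] at h3
    linear_combination h3 - (k ^ 2 + k + c) * h1 - c * g.1 1 0 *
      (2 * k * g.1 0 0 + k * g.1 1 0 + g.1 0 0 + g.1 1 0) * h2
  rcases eq_zero_or_one_of_sq_add_self K hk0 with rfl | rfl
  · refine Or.inl (mem_range_normOneHom hn ?_ ?_)
    · linear_combination hq
    · linear_combination ht
  · refine Or.inr (mem_range_normOneHom ?_ ?_ ?_) <;> rw [hs] <;> simp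
    · exact hn
    · linear_combination hq + g.1 0 0 * h2
    · linear_combination ht + g.1 1 0 * h2

/-- The stabiliser in `PSL_2(q)`, for `q` even, of an external line is dihedral. -/
theorem nonempty_stabilizer_mulEquiv [Finite K] (l : ExternalLine K) :
    Nonempty (stabilizer PSL(2, K) l ≃* DihedralGroup (Nat.card K + 1)) := by
  obtain ⟨c, hc⟩ : ∃ c : K, ∀ u : K, u ^ 2 + u ≠ 1 * c := by
    by_contra! h
    have : (artinSchreier K).range = ⊤ := by
      rw [eq_top_iff]
      rintro c -
      obtain ⟨u, hu⟩ := h c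
      exact ⟨u, by rw [artinSchreier_apply, hu, one_mul]⟩
    have h2 := index_range_artinSchreier K
    rw [this, AddSubgroup.index_top] at h2
    omega
  obtain ⟨g, hg⟩ := isPretransitive.exists_smul_eq l (mkLine ⟨(1, c), hc⟩)
  suffices h : Nonempty (stabilizer PSL(2, K) (mkLine ⟨(1, c), hc⟩) ≃*
      DihedralGroup (Nat.card K + 1)) from
    h.map fun e => (stabilizerEquivStabilizer hg.symm).trans e
  have : Fact (∀ r : K, r ^ 2 ≠ c + 1 * r) := ⟨fun r hr => hc r (by
    rw [hr, one_mul, one_mul, add_assoc, CharTwo.add_self_eq_zero, add_zero])⟩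
  have : Finite (QuadraticAlgebra K c 1) := Finite.of_equiv _ (QuadraticAlgebra.equivProd c 1).symm
  let f := ((QuotientGroup.mk' (Subgroup.center SL(2, K))).comp (normOneHom c)).codRestrict
    (stabilizer PSL(2, K) (mkLine ⟨(1, c), hc⟩)) (normOneHom_mem_stabilizer hc)
  have hf : Function.Injective f := fun u v h =>
    normOneHom_injective (mk_injective (congrArg Subtype.val h))
  obtain ⟨ζ, hζ⟩ := IsCyclic.exists_generator
    (α := (Units.map (QuadraticAlgebra.norm (R := K) (a := c) (b := 1))).ker)
  have hz : ∀ g, g ∈ Subgroup.zpowers (f ζ) ↔ g ∈ f.range := fun g => by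
    rw [← MonoidHom.map_zpowers, (Subgroup.eq_top_iff' _).2 hζ, MonoidHom.range_eq_map]
  refine DihedralGroup.nonempty_mulEquiv (f ζ) ⟨_, shift_one_mem_stabilizer hc⟩ ?_
    (Subtype.ext ?_) (Subtype.ext ?_) ?_ ?_
  · rw [orderOf_injective f hf, orderOf_eq_card_of_forall_mem_zpowers hζ,
      QuadraticAlgebra.card_ker_norm]
  · exact congrArg (QuotientGroup.mk' (Subgroup.center SL(2, K))) shift_one_mul_self
  · exact congrArg (QuotientGroup.mk' (Subgroup.center SL(2, K))) (normOneHom_mul_shift ζ)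
  · rw [hz]
    rintro ⟨u, hu⟩
    exact shift_one_notMem ⟨u, mk_injective (congrArg Subtype.val hu)⟩
  · rintro ⟨g, hg⟩
    simp only [hz]
    induction g using QuotientGroup.induction_on with
    | H g =>
      refine (mem_range_normOneHom_or hc g hg).imp ?_ ?_ <;> rintro ⟨u, hu⟩ <;>
        exact ⟨u, Subtype.ext (congrArg (QuotientGroup.mk' (Subgroup.center SL(2, K))) hu)⟩

end Stabilizer

section Main

variable {K : Type*} [Field K] [CharP K 2] [Finite K]

theorem card_stabilizer (l : ExternalLine K) :
    Nat.card (stabilizer PSL(2, K) l) = 2 * (Nat.card K + 1) := by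
  obtain ⟨e⟩ := nonempty_stabilizer_mulEquiv l
  rw [Nat.card_congr e.toEquiv, DihedralGroup.nat_card]

theorem exists_card_eq_two_pow (K : Type*) [Field K] [CharP K 2] [Finite K] :
    ∃ k, Nat.card K = 2 ^ (k + 1) := by
  have := Fintype.ofFinite K
  obtain ⟨n, -, hn⟩ := FiniteField.card K 2
  refine ⟨n - 1, ?_⟩
  rw [Nat.card_eq_fintype_card, hn, Nat.sub_add_cancel n.pos]

theorem card_psl : Nat.card PSL(2, K) = Nat.card K * ((Nat.card K - 1) * (Nat.card K + 1)) := by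
  have := isPretransitive (K := K)
  obtain ⟨k, hk⟩ := exists_card_eq_two_pow K
  have hl : Nonempty (ExternalLine K) := by
    refine (Nat.card_pos_iff.1 ?_).1
    rw [card_externalLine]
    exact Nat.choose_pos Finite.one_lt_card
  obtain ⟨l⟩ := hl
  rw [← (stabilizer PSL(2, K) l).card_mul_index, card_stabilizer, index_stabilizer_of_transitive,
    card_externalLine, Nat.choose_two_right]
  have h : 2 * (Nat.card K * (Nat.card K - 1) / 2) = Nat.card K * (Nat.card K - 1) := by
    refine Nat.mul_div_cancel' (Dvd.dvd.mul_right ?_ _)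
    rw [hk]
    exact dvd_pow_self 2 k.succ_ne_zero
  rw [mul_comm 2, mul_assoc, h]
  ring

theorem factorization_two_card_psl :
    2 ^ (Nat.card PSL(2, K)).factorization 2 = Nat.card K := by
  obtain ⟨k, hk⟩ := exists_card_eq_two_pow K
  have hp : 0 < 2 ^ k := by positivity
  have hodd : Odd ((Nat.card K - 1) * (Nat.card K + 1)) := by
    rw [hk, pow_succ, Nat.odd_mul]
    exact ⟨⟨2 ^ k - 1, by omega⟩, ⟨2 ^ k, by ring⟩⟩
  rw [card_psl, Nat.factorization_mul Nat.card_pos.ne' hodd.pos.ne', Finsupp.add_apply,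
    Nat.factorization_eq_zero_of_not_dvd hodd.not_two_dvd_nat, add_zero, hk,
    Nat.prime_two.factorization_pow, Finsupp.single_eq_same]

theorem exists_unipotent_mem_stabilizer (l : ExternalLine K) :
    ∃ g ∈ (unipotent K).range, g ≠ 1 ∧ g ∈ stabilizer PSL(2, K) l := by
  obtain ⟨⟨⟨a, c⟩, hx⟩, rfl⟩ := mkLine_surjective l
  have ha : a ≠ 0 := fun h => hx 0 (by simp [h])
  refine ⟨(shift a⁻¹ : SL(2, K)), ⟨Multiplicative.ofAdd a⁻¹, rfl⟩, fun h => ?_, ?_⟩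
  · have h : shift a⁻¹ = 1 := mk_injective h
    have := congrArg (fun g => g.1 0 1) h
    simp [shift, ha] at this
  · rw [mem_stabilizer_mkLine_iff]
    simp [shift]
    field_simp
    linear_combination CharTwo.two_eq_zero (R := K)

theorem hasPropertyStar_two : HasPropertyStar 2 PSL(2, K) (ExternalLine K) := by
  intro P l
  let U : Sylow 2 PSL(2, K) := Sylow.ofCard (unipotent K).range
    (by rw [card_range_unipotent, factorization_two_card_psl])
  obtain ⟨g, rfl⟩ := exists_smul_eq PSL(2, K) U P
  obtain ⟨u, hu, hu1, hul⟩ := exists_unipotent_mem_stabilizer (g⁻¹ • l)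
  set S := stabilizer PSL(2, K) l with hS
  set Q := ((g • U : Sylow 2 PSL(2, K)) : Subgroup PSL(2, K)).subgroupOf S with hQ
  have hmem : g * u * g⁻¹ ∈ S := by
    rw [mem_stabilizer_iff] at hul ⊢
    rw [mul_smul, mul_smul, hul, smul_inv_smul]
  have hne : Q ≠ ⊥ := by
    intro h
    have hmemQ : (⟨g * u * g⁻¹, hmem⟩ : S) ∈ Q := by
      rw [hQ, Subgroup.mem_subgroupOf, Sylow.coe_subgroup_smul]
      exact Subgroup.smul_mem_pointwise_smul u (MulAut.conj g) _ hu
    rw [h, Subgroup.mem_bot] at hmemQ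
    exact hu1 (conj_eq_one_iff.1 (congrArg Subtype.val hmemQ))
  have hQ2 : IsPGroup 2 Q := (g • U).isPGroup'.comap_subtype
  obtain ⟨j, hj⟩ := IsPGroup.iff_card.1 hQ2
  obtain ⟨k, hk⟩ := exists_card_eq_two_pow K
  have hodd : Odd (Nat.card K + 1) := ⟨2 ^ k, by rw [hk]; ring⟩
  have hfac : (Nat.card S).factorization 2 = 1 := by
    rw [hS, card_stabilizer, Nat.factorization_mul two_ne_zero hodd.pos.ne', Finsupp.add_apply,
      Nat.factorization_eq_zero_of_not_dvd hodd.not_two_dvd_nat, add_zero,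
      Nat.prime_two.factorization_self]
  have hle : j ≤ 1 := by
    rw [← hfac, ← Nat.prime_two.pow_dvd_iff_le_factorization Nat.card_pos.ne', ← hj]
    exact Q.card_subgroup_dvd_card
  have hj0 : j ≠ 0 := by
    rintro rfl
    exact hne (Subgroup.card_eq_one.1 hj)
  exact ⟨Sylow.ofCard Q (by rw [hj, hfac]; congr 1; omega), rfl⟩

theorem two_mul_ordProj_card_externalLine_lt (h : 4 ≤ Nat.card K) :
    2 * ordProj[2] (Nat.card (ExternalLine K)) < Nat.card (ExternalLine K) := by
  obtain ⟨k, hk⟩ := exists_card_eq_two_pow K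
  have hp : 0 < 2 ^ k := by positivity
  rw [hk, pow_succ] at h
  have hn : Nat.card (ExternalLine K) = 2 ^ k * (2 ^ k * 2 - 1) := by
    rw [card_externalLine, hk, Nat.choose_two_right, pow_succ, mul_right_comm,
      Nat.mul_div_cancel _ two_pos]
  have hodd : Odd (2 ^ k * 2 - 1) := ⟨2 ^ k - 1, by omega⟩
  have hfac : (2 ^ k * (2 ^ k * 2 - 1)).factorization 2 = k := by
    rw [Nat.factorization_mul hp.ne' hodd.pos.ne', Finsupp.add_apply,
      Nat.factorization_eq_zero_of_not_dvd hodd.not_two_dvd_nat, add_zero,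
      Nat.prime_two.factorization_pow, Finsupp.single_eq_same]
  rw [hn, hfac, mul_comm]
  exact Nat.mul_lt_mul_of_pos_left (by omega) hp

end Main
end Conic

theorem mainTheorem11 (K : Type*) [Field K] [Finite K] (q n : ℕ)
    (hq : Nat.card K = q) (heven : Even q) (hn : Nat.card (Conic.ExternalLine K) = n) :
    n = q.choose 2 ∧
    MulAction.IsPretransitive (Matrix.ProjectiveSpecialLinearGroup (Fin 2) K)
      (Conic.ExternalLine K) ∧
    HasPropertyStar 2 (Matrix.ProjectiveSpecialLinearGroup (Fin 2) K) (Conic.ExternalLine K) ∧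
    (4 ≤ q → 2 * ordProj[2] n < n) ∧
    ∀ l : Conic.ExternalLine K,
      Nonempty (MulAction.stabilizer (Matrix.ProjectiveSpecialLinearGroup (Fin 2) K) l ≃*
        DihedralGroup (q + 1)) ∧
      Even (Nat.card
        (MulAction.stabilizer (Matrix.ProjectiveSpecialLinearGroup (Fin 2) K) l)) := by
  subst hq hn
  have : CharP K 2 := by
    have := Fintype.ofFinite K
    rw [Nat.card_eq_fintype_card, Nat.even_iff, ← FiniteField.even_card_iff_char_two] at heven
    exact heven ▸ ringChar.charP K
  refine ⟨Conic.card_externalLine K, Conic.isPretransitive, Conic.hasPropertyStar_two,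
    Conic.two_mul_ordProj_card_externalLine_lt, fun l =>
    ⟨Conic.nonempty_stabilizer_mulEquiv l, ?_⟩⟩
  rw [Conic.card_stabilizer]
  exact even_two_mul _
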